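/- **Setting.** Let $d\in\{1,2,3\}$ and let $\Omega\subset\mathbb{R}^d$ be a bounded Lipschitz domain with $\partial\Omega=\overline{\Gamma_D\cup\Gamma_N\cup\Gamma_R}$, where $\Gamma_D,\Gamma_N,\Gamma_R$ are pairwise disjoint and $\Gamma_R$ has positive surface measure. Let $\kappa>0$, let $V:=\{v\in W^{1,2}(\Omega;\mathbb{C}) : v=0\text{ on }\Gamma_D\}$ (in the sense of traces) with $\|v\|_V:=(\kappa^2\|v\|_{L^2(\Omega)}^2+\|\nabla v\|_{L^2(\Omega)}^2)^{1/2}$, and for $u,v\in V$ let $$a(u,v):=\int_\Omega\nabla u\cdot\overline{\nabla v}\,dx-\kappa^2\int_\Omega u\overline v\,dx-i\kappa\int_{\Gamma_R}u\overline v\,ds .$$ Let $C_a$ be a constant with $|a(u,v)|\le C_a\|u\|_V\|v\|_V$ for all $u,v\in V$. Let $\mathcal{T}_H$ be a regular (face-to-face) simplicial mesh of $\Omega$ with local mesh widths $H_T:=\operatorname{diam}T$ and mesh size $H:=\max_{T\in\mathcal{T}_H}H_T$. For $T\in\mathcal{T}_H$ let $\Omega_{T,1}:=\bigcup\{T'\in\mathcal{T}_H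 : T'\cap T\ne\emptyset\}$, and let $C_{\mathrm{ol}}:=\max_{T\in\mathcal T_H}\#\{K\in\mathcal{T}_H : K\subset\Omega_{T,1}\}$. Let $\mathcal{N}_H$ be the set of the vertices of $\mathcal T_H$ that do not lie in $\overline{\Gamma_D}$, let $\phi_z$ be the continuous piecewise affine nodal basis function of the vertex $z$, and let $$\mathcal{I}_Hv:=\sum_{z\in\mathcal{N}_H}\frac{\int_\Omega v\,\phi_z\,dx}{\int_\Omega\phi_z\,dx}\,\phi_z,\qquad W:=\{v\in V : \mathcal{I}_Hv=0\}.$$ Let $C_I>0$ be a constant with $$H_T^{-1}\|v-\mathcal{I}_Hv\|_{L^2(T)}+\|\nabla(v-\mathcal{I}_Hv)\|_{L^2(T)}\le C_I\|\nabla v\|_{L^2(\Omega_{T,1})}\quad\text{for all }v\in V,\ T\in\mathcal{T}_H .$$ **Lemma (well-posedness of the correction operator).** Assume the resolution condition $H\kappa\le\dfrac{1}{\sqrt{2C_{\mathrm{ol}}}\,C_I}$. Then: 1. $\|\nabla w\|_{L^2(\Omega)}\le\|w\|_V\le\sqrt{3/2}\,\|\nabla w\|_{L^2(\Omega)}$ for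 all $w\in W$, so that $\|\nabla\cdot\|_{L^2(\Omega)}$ and $\|\cdot\|_V$ are equivalent norms on $W$. 2. $\operatorname{Re}a(w,w)\ge\frac13\|w\|_V^2$ for all $w\in W$. 3. For every $v\in V$ there is exactly one $\mathcal{C}_\infty v\in W$ with $a(\mathcal{C}_\infty v,w)=a(v,w)$ for all $w\in W$, and exactly one $\mathcal{C}^*_\infty v\in W$ with $a(w,\mathcal{C}^*_\infty v)=a(w,v)$ for all $w\in W$. The maps $\mathcal{C}_\infty,\mathcal{C}_\infty^*:V\to W$ are linear, and $$\|\mathcal{C}_\infty v\|_V\le 3C_a\|v\|_V,\qquad \|\mathcal{C}^*_\infty v\|_V\le 3C_a\|v\|_V\qquad\text{for all }v\in V .$$ Moreover, for every $v\in V$ one has $\overline v\in V$, $\mathcal{C}_\infty^*v=\overline{\mathcal{C}_\infty\overline v}$ and $\|\mathcal{C}_\infty^*v\|_V=\|\mathcal{C}_\infty\overline v\|_V$ (hence $\|\mathcal{C}_\infty^*v\|_V=\|\mathcal{C}_\infty v\|_V$ for real-valued $v$). -/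

import Mathlib

open MeasureTheory Set
open scoped ContDiff ComplexConjugate NNReal ENNReal

noncomputable section

namespace Helmholtz

/-- Euclidean space `ℝ^d`. -/
abbrev Rd (d : ℕ) : Type := EuclideanSpace ℝ (Fin d)

/-- The space `ℂ^d` with its Hermitian inner product (values of gradients). -/
abbrev Cd (d : ℕ) : Type := EuclideanSpace ℂ (Fin d)

variable {d : ℕ}

/-! ### Domain and boundary -/

/-- A bounded Lipschitz domain: a bounded connected (nonempty) open set which, near each of its
boundary points and after a rotation (`e` is the vertical direction, `y - ⟪e, y⟫ e` the horizontal
part of `y`), is the set of points above the graph of a Lipschitz function. -/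
structure IsLipschitzDomain (Ω : Set (Rd d)) : Prop where
  isOpen : IsOpen Ω
  isConnected : IsConnected Ω
  isBounded : Bornology.IsBounded Ω
  lipschitz_boundary : ∀ x ∈ frontier Ω, ∃ (e : Rd d) (r : ℝ) (K : ℝ≥0) (g : Rd d → ℝ),
    ‖e‖ = 1 ∧ 0 < r ∧ LipschitzWith K g ∧
      ∀ y ∈ Metric.ball x r, y ∈ Ω ↔ g (y - inner ℝ e y • e) < inner ℝ e y

/-- The surface measure: the `(d-1)`-dimensional Hausdorff measure, normalised so that it is the
usual area on hyperplanes. -/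
def surface (d : ℕ) : Measure (Rd d) := Measure.euclideanHausdorffMeasure (d - 1)

/-- The boundary of `Ω` is split into a Dirichlet, a Neumann and a Robin part; the Robin part has
positive surface measure. -/
structure IsBoundaryPartition (Ω ΓD ΓN ΓR : Set (Rd d)) : Prop where
  measurableSet_dirichlet : MeasurableSet ΓD
  measurableSet_neumann : MeasurableSet ΓN
  measurableSet_robin : MeasurableSet ΓR
  disjoint_dirichlet_neumann : Disjoint ΓD ΓN
  disjoint_dirichlet_robin : Disjoint ΓD ΓR
  disjoint_neumann_robin : Disjoint ΓN ΓR
  frontier_eq : frontier Ω = closure (ΓD ∪ ΓN ∪ ΓR)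
  robin_pos : 0 < surface d ΓR

/-! ### The Sobolev space -/

/-- The complex scalar-valued space `L²(Ω)`. -/
abbrev L2 (Ω : Set (Rd d)) : Type := Lp ℂ 2 ((volume : Measure (Rd d)).restrict Ω)

/-- The space `L²(Ω)^d` of complex vector fields. -/
abbrev L2vec (Ω : Set (Rd d)) : Type := Lp (Cd d) 2 ((volume : Measure (Rd d)).restrict Ω)

/-- The space `L²(S)` on a part `S` of the boundary. -/
abbrev L2bdry (S : Set (Rd d)) : Type := Lp ℂ 2 ((surface d).restrict S)

/-- The classical partial derivative `∂ᵢφ (x)`. -/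
def pderiv {F : Type} [NormedAddCommGroup F] [NormedSpace ℝ F] (i : Fin d) (φ : Rd d → F)
    (x : Rd d) : F :=
  fderiv ℝ φ x (EuclideanSpace.single i 1)

/-- The classical gradient of a complex-valued function. -/
def cgrad (φ : Rd d → ℂ) (x : Rd d) : Cd d := WithLp.toLp 2 fun i => pderiv i φ x

/-- `G` is the weak gradient of `u` on `Ω`. -/
def IsWeakGradient (Ω : Set (Rd d)) (u : L2 Ω) (G : L2vec Ω) : Prop :=
  ∀ φ : Rd d → ℝ, ContDiff ℝ ∞ φ → HasCompactSupport φ → tsupport φ ⊆ Ω → ∀ i : Fin d,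
    ∫ x in Ω, pderiv i φ x • u x = -∫ x in Ω, φ x • (G x) i

/-- Smooth functions on `ℝ^d`, recorded through their restriction to `Ω`, the restriction of the
gradient to `Ω`, and the restriction to the part `S` of the boundary. -/
def smoothGraph (Ω S : Set (Rd d)) : Submodule ℂ (L2 Ω × L2vec Ω × L2bdry S) where
  carrier := {p | ∃ φ : Rd d → ℂ, ContDiff ℝ ∞ φ ∧
    p.1 =ᵐ[volume.restrict Ω] φ ∧ p.2.1 =ᵐ[volume.restrict Ω] cgrad φ ∧
    p.2.2 =ᵐ[(surface d).restrict S] φ}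
  zero_mem' := by
    refine ⟨fun _ => 0, contDiff_const, Lp.coeFn_zero _ _ _, ?_, Lp.coeFn_zero _ _ _⟩
    filter_upwards [Lp.coeFn_zero (Cd d) 2 ((volume : Measure (Rd d)).restrict Ω)] with x hx
    rw [Prod.snd_zero, Prod.fst_zero, hx]
    ext i
    simp [cgrad, pderiv]
  add_mem' := by
    rintro p q ⟨φ, hφ, h1, h2, h3⟩ ⟨ψ, hψ, k1, k2, k3⟩
    refine ⟨φ + ψ, hφ.add hψ, (Lp.coeFn_add _ _).trans (h1.add k1), ?_,
      (Lp.coeFn_add _ _).trans (h3.add k3)⟩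
    filter_upwards [Lp.coeFn_add p.2.1 q.2.1, h2, k2] with x hx e2 f2
    rw [Prod.snd_add, Prod.fst_add, hx, Pi.add_apply, e2, f2]
    ext i
    simp [cgrad, pderiv, fderiv_add (hφ.differentiable (by simp) x)
      (hψ.differentiable (by simp) x)]
  smul_mem' := by
    rintro c p ⟨φ, hφ, h1, h2, h3⟩
    refine ⟨c • φ, hφ.const_smul c, (Lp.coeFn_smul _ _).trans (h1.const_smul c), ?_,
      (Lp.coeFn_smul _ _).trans (h3.const_smul c)⟩
    filter_upwards [Lp.coeFn_smul c p.2.1, h2] with x hx e2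
    rw [Prod.smul_snd, Prod.smul_fst, hx, Pi.smul_apply, e2]
    ext i
    simp [cgrad, pderiv, fderiv_const_smul (hφ.differentiable (by simp) x) c]

/-- The graph of `u ↦ (∇u, u|_S)` on `W^{1,2}(Ω)`, where `u|_S ∈ L²(S)` is the trace: the triples
`(u, G, g)` for which some smooth functions `φₙ` satisfy `φₙ → u` and `∇φₙ → G` in `L²(Ω)` and
`φₙ|_S → g` in `L²(S)`. -/
def traceGraph (Ω S : Set (Rd d)) : Submodule ℂ (L2 Ω × L2vec Ω × L2bdry S) :=
  (smoothGraph Ω S).topologicalClosure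

lemma integrable_smul_L2 {Ω : Set (Rd d)} {ψ : Rd d → ℝ} {f : Rd d → ℂ} (hψ : Continuous ψ)
    (hc : HasCompactSupport ψ) (hf : MemLp f 2 (volume.restrict Ω)) :
    Integrable (fun x => ψ x • f x) (volume.restrict Ω) :=
  memLp_one_iff_integrable.mp
    (hf.smul ((hψ.memLp_of_hasCompactSupport (μ := volume) (p := 2) hc).restrict Ω) (r := 1))

lemma memLp_coord {Ω : Set (Rd d)} (G : L2vec Ω) (i : Fin d) :
    MemLp (fun x => (G x) i) 2 (volume.restrict Ω) :=
  (EuclideanSpace.proj (𝕜 := ℂ) i).comp_memLp G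

lemma continuous_pderiv {φ : Rd d → ℝ} (hφ : ContDiff ℝ ∞ φ) (i : Fin d) :
    Continuous (pderiv i φ) :=
  (hφ.continuous_fderiv (by simp)).clm_apply continuous_const

lemma hasCompactSupport_pderiv {φ : Rd d → ℝ} (hφ : HasCompactSupport φ) (i : Fin d) :
    HasCompactSupport (pderiv i φ) :=
  hφ.fderiv_apply (𝕜 := ℝ) (EuclideanSpace.single i 1)

lemma IsWeakGradient.add {Ω : Set (Rd d)} {u u' : L2 Ω} {G G' : L2vec Ω}
    (h : IsWeakGradient Ω u G) (h' : IsWeakGradient Ω u' G') :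
    IsWeakGradient Ω (u + u') (G + G') := by
  intro φ hφ hc hs i
  have e1 : ∫ x in Ω, pderiv i φ x • (u + u' : L2 Ω) x =
      ∫ x in Ω, (pderiv i φ x • u x + pderiv i φ x • u' x) := by
    refine integral_congr_ae ?_
    filter_upwards [Lp.coeFn_add u u'] with x hx
    rw [hx, Pi.add_apply, smul_add]
  have e2 : ∫ x in Ω, φ x • ((G + G' : L2vec Ω) x) i =
      ∫ x in Ω, (φ x • (G x) i + φ x • (G' x) i) := by
    refine integral_congr_ae ?_
    filter_upwards [Lp.coeFn_add G G'] with x hx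
    rw [hx, Pi.add_apply, PiLp.add_apply, smul_add]
  rw [e1, e2, integral_add, integral_add, h φ hφ hc hs i, h' φ hφ hc hs i, neg_add]
  · exact integrable_smul_L2 hφ.continuous hc (memLp_coord G i)
  · exact integrable_smul_L2 hφ.continuous hc (memLp_coord G' i)
  · exact integrable_smul_L2 (continuous_pderiv hφ i) (hasCompactSupport_pderiv hc i) (Lp.memLp u)
  · exact integrable_smul_L2 (continuous_pderiv hφ i) (hasCompactSupport_pderiv hc i) (Lp.memLp u')

lemma IsWeakGradient.smul {Ω : Set (Rd d)} {u : L2 Ω} {G : L2vec Ω} (c : ℂ)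
    (h : IsWeakGradient Ω u G) : IsWeakGradient Ω (c • u) (c • G) := by
  intro φ hφ hc hs i
  have e1 : ∫ x in Ω, pderiv i φ x • (c • u : L2 Ω) x = ∫ x in Ω, c • (pderiv i φ x • u x) := by
    refine integral_congr_ae ?_
    filter_upwards [Lp.coeFn_smul c u] with x hx
    rw [hx, Pi.smul_apply, smul_comm]
  have e2 : ∫ x in Ω, φ x • ((c • G : L2vec Ω) x) i = ∫ x in Ω, c • (φ x • (G x) i) := by
    refine integral_congr_ae ?_
    filter_upwards [Lp.coeFn_smul c G] with x hx
    rw [hx, Pi.smul_apply, PiLp.smul_apply, smul_comm]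
  rw [e1, e2, integral_smul, integral_smul, h φ hφ hc hs i, smul_neg]

lemma IsWeakGradient.zero (Ω : Set (Rd d)) : IsWeakGradient Ω (0 : L2 Ω) (0 : L2vec Ω) := by
  intro φ hφ hc hs i
  have e1 : ∫ x in Ω, pderiv i φ x • (0 : L2 Ω) x = 0 := by
    rw [← integral_zero (Rd d) ℂ (μ := volume.restrict Ω)]
    refine integral_congr_ae ?_
    filter_upwards [Lp.coeFn_zero ℂ 2 ((volume : Measure (Rd d)).restrict Ω)] with x hx
    rw [hx, Pi.zero_apply, smul_zero]
  have e2 : ∫ x in Ω, φ x • ((0 : L2vec Ω) x) i = 0 := by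
    rw [← integral_zero (Rd d) ℂ (μ := volume.restrict Ω)]
    refine integral_congr_ae ?_
    filter_upwards [Lp.coeFn_zero (Cd d) 2 ((volume : Measure (Rd d)).restrict Ω)] with x hx
    rw [hx, Pi.zero_apply, PiLp.zero_apply, smul_zero]
  rw [e1, e2, neg_zero]

/-- The space `V = {v ∈ W^{1,2}(Ω) | v = 0 on Γ_D}`. A function `v ∈ V` is recorded together with
its weak gradient and its trace on `Γ_D ∪ Γ_R` (the part of the boundary where boundary values
enter the problem); both are determined by `v` when `Ω` is a bounded Lipschitz domain, and every
`v ∈ W^{1,2}(Ω)` has them. -/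
def V (Ω ΓD ΓR : Set (Rd d)) : Submodule ℂ (L2 Ω × L2vec Ω × L2bdry (ΓD ∪ ΓR)) where
  carrier := {p | IsWeakGradient Ω p.1 p.2.1 ∧ p ∈ traceGraph Ω (ΓD ∪ ΓR) ∧
    ∀ᵐ x ∂((surface d).restrict (ΓD ∪ ΓR)), x ∈ ΓD → p.2.2 x = 0}
  zero_mem' := by
    refine ⟨IsWeakGradient.zero Ω, zero_mem _, ?_⟩
    filter_upwards [Lp.coeFn_zero ℂ 2 ((surface d).restrict (ΓD ∪ ΓR))] with x hx _
    rw [Prod.snd_zero, Prod.snd_zero, hx, Pi.zero_apply]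
  add_mem' := by
    rintro p q ⟨h1, h2, h3⟩ ⟨k1, k2, k3⟩
    refine ⟨h1.add k1, add_mem h2 k2, ?_⟩
    filter_upwards [Lp.coeFn_add p.2.2 q.2.2, h3, k3] with x hx e f hD
    rw [Prod.snd_add, Prod.snd_add, hx, Pi.add_apply, e hD, f hD, add_zero]
  smul_mem' := by
    rintro c p ⟨h1, h2, h3⟩
    refine ⟨h1.smul c, Submodule.smul_mem _ c h2, ?_⟩
    filter_upwards [Lp.coeFn_smul c p.2.2, h3] with x hx e hD
    rw [Prod.smul_snd, Prod.smul_snd, hx, Pi.smul_apply, e hD, smul_zero]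

section Form

variable {Ω ΓD ΓR : Set (Rd d)}

/-- The underlying function of `v ∈ V`. -/
def fn (v : V Ω ΓD ΓR) : L2 Ω := v.1.1

/-- The weak gradient of `v ∈ V`. -/
def grad (v : V Ω ΓD ΓR) : L2vec Ω := v.1.2.1

/-- The trace of `v ∈ V` on `Γ_D ∪ Γ_R`. -/
def tr (v : V Ω ΓD ΓR) : L2bdry (ΓD ∪ ΓR) := v.1.2.2

/-- The `κ`-weighted norm `‖v‖_V = (κ² ‖v‖² + ‖∇v‖²)^{1/2}`. -/
def normV (κ : ℝ) (v : V Ω ΓD ΓR) : ℝ := √(κ ^ 2 * ‖fn v‖ ^ 2 + ‖grad v‖ ^ 2)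

/-- The Helmholtz form `a(u, v) = (∇u, ∇v)_Ω - κ² (u, v)_Ω - iκ (u, v)_{Γ_R}`, with inner products
that are conjugate-linear in the second argument `v` of `a`. -/
def form (κ : ℝ) (u v : V Ω ΓD ΓR) : ℂ :=
  (∫ x in Ω, ∑ i, (grad u x) i * conj ((grad v x) i))
    - (κ : ℂ) ^ 2 * (∫ x in Ω, fn u x * conj (fn v x))
    - Complex.I * (κ : ℂ) * (∫ x in ΓR, tr u x * conj (tr v x) ∂(surface d))

/-- `C_a` is a continuity constant of the form `a`. -/
def IsContinuityConstant (Ω ΓD ΓR : Set (Rd d)) (κ Ca : ℝ) : Prop :=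
  ∀ u v : V Ω ΓD ΓR, ‖form κ u v‖ ≤ Ca * normV κ u * normV κ v

/-- `v'` is the complex conjugate of `v`. -/
def IsConj (v v' : V Ω ΓD ΓR) : Prop :=
  (∀ᵐ x ∂((volume : Measure (Rd d)).restrict Ω), fn v' x = conj (fn v x)) ∧
  (∀ᵐ x ∂((volume : Measure (Rd d)).restrict Ω), ∀ i, (grad v' x) i = conj ((grad v x) i)) ∧
  (∀ᵐ x ∂((surface d).restrict (ΓD ∪ ΓR)), tr v' x = conj (tr v x))

end Form

/-! ### Meshes -/

/-- A regular (face-to-face) simplicial mesh of `Ω`. An element is given by the finite set of its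
`d + 1` affinely independent vertices; two elements meet in the (possibly empty) face spanned by
their common vertices; the closed elements cover exactly `closure Ω`. -/
structure Mesh (Ω : Set (Rd d)) where
  elements : Finset (Finset (Rd d))
  card_eq : ∀ s ∈ elements, s.card = d + 1
  indep : ∀ s ∈ elements, AffineIndependent ℝ ((↑) : s → Rd d)
  inter_subset : ∀ s ∈ elements, ∀ t ∈ elements,
    convexHull ℝ (s : Set (Rd d)) ∩ convexHull ℝ (t : Set (Rd d)) ⊆
      convexHull ℝ ((s : Set (Rd d)) ∩ (t : Set (Rd d)))
  cover : ⋃ s ∈ elements, convexHull ℝ (s : Set (Rd d)) = closure Ω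

/-- The closed simplex with vertex set `s`. -/
def simplex (s : Finset (Rd d)) : Set (Rd d) := convexHull ℝ (s : Set (Rd d))

namespace Mesh

variable {Ω : Set (Rd d)} (T : Mesh Ω)

/-- The mesh size `H`, the maximum of the local mesh widths `H_s = diam s`. -/
def size : ℝ := ⨆ s : T.elements, Metric.diam (simplex s.1)

open Classical in
/-- The element patch `Ω_{s,1}`, the union of `s` and its neighbours. -/
def patch (s : Finset (Rd d)) : Set (Rd d) :=
  ⋃ t ∈ {t ∈ T.elements | (simplex t ∩ simplex s).Nonempty}, simplex t

open Classical in
/-- The overlap constant `C_ol`, the maximal number of elements in an element patch. -/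
def overlap : ℕ := T.elements.sup fun s => {t ∈ T.elements | simplex t ⊆ T.patch s}.card

/-- The barycentric coordinate system of an element. -/
def basis (s : T.elements) : AffineBasis s.1 ℝ (Rd d) where
  toFun := (↑)
  ind' := T.indep s.1 s.2
  tot' := by
    rw [(T.indep s.1 s.2).affineSpan_eq_top_iff_card_eq_finrank_add_one]
    simp [T.card_eq s.1 s.2]

open Classical in
/-- The barycentric coordinate of `x` belonging to the vertex `z`, if `x` lies in the element `s`
and `z` is a vertex of `s`; zero otherwise. -/
def localHat (s : T.elements) (z x : Rd d) : ℝ≥0 :=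
  if h : z ∈ s.1 then
    if x ∈ simplex s.1 then ((T.basis s).coord ⟨z, h⟩ x).toNNReal else 0
  else 0

/-- The real-valued nodal basis function (hat function) `φ_z`: continuous and piecewise affine,
equal to `1` at `z` and to `0` at all other vertices. In an element it is the barycentric
coordinate of `z`; all elements containing a point yield the same value there, except that an
element without the vertex `z` contributes `0`. -/
def hat (z x : Rd d) : ℝ := ((T.elements.attach.sup fun s => T.localHat s z x : ℝ≥0) : ℝ)

open Classical in
/-- The set `N_H` of the vertices that do not lie on the Dirichlet boundary. -/
def nodes (ΓD : Set (Rd d)) : Finset (Rd d) :=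
  {z ∈ T.elements.biUnion id | z ∉ closure ΓD}

lemma isCompact_simplex (s : Finset (Rd d)) : IsCompact (simplex s) :=
  s.finite_toSet.isCompact_convexHull ℝ

lemma measurable_localHat (s : T.elements) (z : Rd d) : Measurable (T.localHat s z) := by
  classical
  unfold localHat
  by_cases h : z ∈ s.1
  · simp only [h, dite_true]
    refine Measurable.ite (isCompact_simplex s.1).isClosed.measurableSet ?_ measurable_const
    exact (AffineMap.continuous_of_finiteDimensional
      ((T.basis s).coord ⟨z, h⟩)).measurable.real_toNNReal
  · simp only [h, dite_false]
    exact measurable_const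

lemma measurable_hat (z : Rd d) : Measurable (T.hat z) := by
  unfold hat
  refine Measurable.coe_nnreal_real ?_
  induction T.elements.attach using Finset.cons_induction with
  | empty => simp
  | cons s F hs ih =>
    simp only [Finset.sup_cons]
    exact (T.measurable_localHat s z).sup ih

lemma localHat_le_one (s : T.elements) (z x : Rd d) : T.localHat s z x ≤ 1 := by
  classical
  unfold localHat
  split_ifs with h hx
  · have hr : Set.range (T.basis s) = (s.1 : Set (Rd d)) := Subtype.range_coe
    have hx' : x ∈ convexHull ℝ (Set.range (T.basis s)) := by rw [hr]; exact hx
    rw [AffineBasis.convexHull_eq_nonneg_coord] at hx'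
    rw [Real.toNNReal_le_one, ← (T.basis s).sum_coord_apply_eq_one x]
    exact Finset.single_le_sum (f := fun i => (T.basis s).coord i x) (fun i _ => hx' i)
      (Finset.mem_univ _)
  · exact zero_le_one
  · exact zero_le_one

lemma hat_nonneg (z x : Rd d) : 0 ≤ T.hat z x := NNReal.coe_nonneg _

lemma hat_le_one (z x : Rd d) : T.hat z x ≤ 1 := by
  unfold hat
  exact_mod_cast Finset.sup_le fun s _ => T.localHat_le_one s z x

lemma volume_lt_top {Ω : Set (Rd d)} (T : Mesh Ω) : volume Ω < ⊤ := by
  have h : IsCompact (closure Ω) := by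
    rw [← T.cover]
    exact T.elements.isCompact_biUnion fun s _ => isCompact_simplex s
  exact (measure_mono subset_closure).trans_lt h.measure_lt_top

lemma memLp_hat (z : Rd d) : MemLp (fun x => (T.hat z x : ℂ)) 2 (volume.restrict Ω) := by
  have : IsFiniteMeasure ((volume : Measure (Rd d)).restrict Ω) :=
    ⟨by simpa using T.volume_lt_top⟩
  refine MemLp.of_bound
    (Complex.measurable_ofReal.comp (T.measurable_hat z)).aestronglyMeasurable 1 ?_
  filter_upwards with x
  rw [Complex.norm_real, Real.norm_of_nonneg (T.hat_nonneg z x)]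
  exact T.hat_le_one z x

section Interpolation

variable {ΓD ΓR : Set (Rd d)}

/-- The nodal functional `α_z(v) = (v, φ_z)_Ω / (1, φ_z)_Ω`. -/
def nodal (z : Rd d) (v : V Ω ΓD ΓR) : ℂ :=
  (∫ x in Ω, fn v x * (T.hat z x : ℂ)) / (∫ x in Ω, (T.hat z x : ℂ))

/-- The weighted Clément interpolant `I_H v = ∑_z α_z(v) φ_z`. -/
def interp (v : V Ω ΓD ΓR) (x : Rd d) : ℂ :=
  ∑ z ∈ T.nodes ΓD, T.nodal z v * (T.hat z x : ℂ)

lemma integrable_mul_hat (z : Rd d) (u : L2 Ω) :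
    Integrable (fun x => u x * (T.hat z x : ℂ)) (volume.restrict Ω) :=
  (Lp.memLp u).integrable_mul (T.memLp_hat z)

lemma nodal_add (z : Rd d) (v w : V Ω ΓD ΓR) :
    T.nodal z (v + w) = T.nodal z v + T.nodal z w := by
  unfold nodal
  rw [← add_div, ← integral_add (T.integrable_mul_hat z (fn v)) (T.integrable_mul_hat z (fn w))]
  congr 1
  refine integral_congr_ae ?_
  filter_upwards [Lp.coeFn_add (fn v) (fn w)] with x hx
  rw [← add_mul, ← Pi.add_apply, ← hx]
  rfl

lemma nodal_smul (z : Rd d) (c : ℂ) (v : V Ω ΓD ΓR) :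
    T.nodal z (c • v) = c * T.nodal z v := by
  unfold nodal
  rw [← mul_div_assoc, ← integral_const_mul]
  congr 1
  refine integral_congr_ae ?_
  filter_upwards [Lp.coeFn_smul c (fn v)] with x hx
  rw [← mul_assoc, ← smul_eq_mul c, ← Pi.smul_apply, ← hx]
  rfl

lemma interp_add (v w : V Ω ΓD ΓR) (x : Rd d) :
    T.interp (v + w) x = T.interp v x + T.interp w x := by
  simp [interp, nodal_add, add_mul, Finset.sum_add_distrib]

lemma interp_smul (c : ℂ) (v : V Ω ΓD ΓR) (x : Rd d) :
    T.interp (c • v) x = c * T.interp v x := by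
  simp [interp, nodal_smul, Finset.mul_sum, mul_assoc]

variable (ΓD ΓR) in
/-- The remainder space `W = ker I_H ⊆ V`. -/
def W : Submodule ℂ (V Ω ΓD ΓR) where
  carrier := {v | ∀ᵐ x ∂((volume : Measure (Rd d)).restrict Ω), T.interp v x = 0}
  zero_mem' := by
    rw [mem_ofPred_eq]
    refine Filter.Eventually.of_forall fun x => ?_
    simpa using T.interp_smul 0 (0 : V Ω ΓD ΓR) x
  add_mem' := by
    intro v w hv hw
    rw [mem_ofPred_eq] at hv hw ⊢
    filter_upwards [hv, hw] with x h k
    rw [interp_add, h, k, add_zero]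
  smul_mem' := by
    intro c v hv
    rw [mem_ofPred_eq] at hv ⊢
    filter_upwards [hv] with x h
    rw [interp_smul, h, mul_zero]

/-- The `L²`-norm over (the part inside the open set `Ω` of) the closed set `S`. -/
def normOn {F : Type} [NormedAddCommGroup F] (Ω S : Set (Rd d)) (f : Rd d → F) : ℝ :=
  √(∫ x in S ∩ Ω, ‖f x‖ ^ 2)

variable (ΓD ΓR) in
/-- `C_I` is an admissible constant in the local approximation and stability estimate
`H_s⁻¹ ‖v - I_H v‖_{L²(s)} + ‖∇(v - I_H v)‖_{L²(s)} ≤ C_I ‖∇v‖_{L²(Ω_{s,1})}`. -/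
def IsInterpolationConstant (CI : ℝ) : Prop :=
  ∀ v : V Ω ΓD ΓR, ∀ s ∈ T.elements,
    (Metric.diam (simplex s))⁻¹ * normOn Ω (simplex s) (fun x => fn v x - T.interp v x)
      + normOn Ω (simplex s) (fun x => grad v x - cgrad (T.interp v) x)
    ≤ CI * normOn Ω (T.patch s) (fun x => grad v x)

end Interpolation

end Mesh

end Helmholtz

end

/-! On the kernel `W` the interpolant disappears from the local approximation estimate, so on each
element the `L²` norm of `w` is at most `H C_I` times the gradient norm on the patch. Squaring and
summing costs a factor `C_ol`, because almost every point lies in at most `C_ol` patches. The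
resolution condition turns this into `κ² ‖w‖² ≤ ½ ‖∇w‖²` (`kappa_norm_fn_sq_le`), from which the
norm equivalence and the coercivity of `Re a` on `W` follow by arithmetic.

Existence is Lax–Milgram (`exists_linearMap_inner_eq`) in the Hilbert space of triples (function,
gradient, trace), where `a` is given by the bounded operator `diag(-κ², 1, -iκ)`. The Hilbert norm
contains the trace and `‖·‖_V` does not. No trace theorem is needed to bridge the gap: the imaginary
part of `a(v,v)` is `-κ ‖tr v‖²`, so the assumed continuity of `a` bounds the trace by `‖·‖_V`
(`norm_embed_sq_le`). Completeness comes from the closedness of `V` and `W`.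

The dual corrector is the same theorem for the adjoint operator. Its link to the primal one is the
identity `a(ū, v̄) = a(v, u)` (`IsConj.form_eq`), together with the invariance of `W` under
conjugation. -/

noncomputable section

namespace Helmholtz

variable {d : ℕ}

/-! ### Mesh geometry and finite overlap of the patches -/

namespace Mesh

/-- Two different elements of a mesh overlap in a null set. -/
lemma volume_simplex_inter_eq_zero {Ω : Set (Rd d)} (T : Mesh Ω) {s t : Finset (Rd d)}
    (hs : s ∈ T.elements) (ht : t ∈ T.elements) (hst : s ≠ t) :
    volume (simplex s ∩ simplex t) = 0 := by
  classical
  refine measure_mono_null (T.inter_subset s hs t ht) ?_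
  rw [← Finset.coe_inter]
  refine measure_mono_null (convexHull_subset_affineSpan _) ?_
  refine Measure.addHaar_affineSubspace volume _ fun htop => ?_
  -- Distinct elements share at most `d` vertices, too few to span the whole space; a proper affine
  -- subspace is a null set.
  have hlt : (s ∩ t).card < d + 1 := by
    rw [← T.card_eq s hs]
    refine Finset.card_lt_card (Finset.ssubset_iff_subset_ne.mpr ⟨Finset.inter_subset_left, ?_⟩)
    intro h
    exact hst (Finset.eq_of_subset_of_card_le (Finset.inter_eq_left.mp h)
      (by rw [T.card_eq s hs, T.card_eq t ht]))
  have hi : AffineIndependent ℝ ((↑) : (s ∩ t : Finset (Rd d)) → Rd d) :=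
    (T.indep s hs).mono (by simp)
  have hr : affineSpan ℝ (Set.range ((↑) : (s ∩ t : Finset (Rd d)) → Rd d)) = ⊤ := by
    rw [Subtype.range_coe]
    exact htop
  rw [hi.affineSpan_eq_top_iff_card_eq_finrank_add_one] at hr
  simp at hr
  omega

lemma measurableSet_simplex (s : Finset (Rd d)) : MeasurableSet (simplex s) :=
  (isCompact_simplex s).isClosed.measurableSet

lemma measurableSet_patch {Ω : Set (Rd d)} (T : Mesh Ω) (s : Finset (Rd d)) :
    MeasurableSet (T.patch s) := by
  classical
  exact Finset.measurableSet_biUnion _ fun t _ => measurableSet_simplex t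

/-- Almost every point lies in at most `C_ol` element patches. -/
lemma ae_card_patch_le {Ω : Set (Rd d)} (T : Mesh Ω) :
    ∀ᵐ x ∂(volume : Measure (Rd d)),
      ∑ s ∈ T.elements, (T.patch s).indicator (fun _ => (1 : ℝ)) x ≤ T.overlap := by
  classical
  have h : ∀ᵐ x ∂(volume : Measure (Rd d)), ∀ s ∈ T.elements, ∀ t ∈ T.elements, s ≠ t →
      x ∉ simplex s ∩ simplex t := by
    refine (Finset.eventually_all _).mpr fun s hs => (Finset.eventually_all _).mpr fun t ht => ?_
    refine Filter.eventually_imp_distrib_left.mpr fun hst => ?_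
    exact measure_eq_zero_iff_ae_notMem.mp (T.volume_simplex_inter_eq_zero hs ht hst)
  filter_upwards [h] with x hx
  by_cases hex : ∃ t ∈ T.elements, x ∈ simplex t
  · obtain ⟨t, ht, hxt⟩ := hex
    -- Off the null overlaps, `t` is the only element containing `x`. A patch of `s` containing `x`
    -- must therefore contain it through `t`, so `s` touches `t` and, by symmetry, lies in the patch
    -- of `t`.
    have hle : {s ∈ T.elements | x ∈ T.patch s}.card ≤ T.overlap := by
      refine le_trans (Finset.card_le_card ?_) (Finset.le_sup
        (f := fun s => {t ∈ T.elements | simplex t ⊆ T.patch s}.card) ht)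
      intro s hs
      rw [Finset.mem_filter] at hs ⊢
      refine ⟨hs.1, ?_⟩
      obtain ⟨t', ht', hxt'⟩ := mem_iUnion₂.mp hs.2
      rw [Finset.mem_filter] at ht'
      have htt : t = t' := by
        by_contra hne
        exact hx t ht t' ht'.1 hne ⟨hxt, hxt'⟩
      subst htt
      refine subset_iUnion₂ (s := fun t (_ : t ∈ _) => simplex t) s ?_
      rw [Finset.mem_filter]
      exact ⟨hs.1, by rw [inter_comm]; exact ht'.2⟩
    rw [Finset.sum_indicator_eq_sum_filter]
    simpa using hle
  · rw [Finset.sum_eq_zero]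
    · exact Nat.cast_nonneg _
    · intro s _
      refine indicator_of_notMem (fun hxs => hex ?_) _
      obtain ⟨t', ht', hxt'⟩ := mem_iUnion₂.mp hxs
      exact ⟨t', (Finset.mem_filter.mp ht').1, hxt'⟩

/-- Summation over elements becomes a pointwise weight counting how many of the sets contain `x`.
This count is at most `C_ol` almost everywhere for patches and at least `1` on `Ω` for simplices,
which gives the two inequalities below. -/
lemma sum_setIntegral_eq {Ω : Set (Rd d)} (T : Mesh Ω) {A : Finset (Rd d) → Set (Rd d)}
    (hA : ∀ s, MeasurableSet (A s)) {f : Rd d → ℝ} (hf : IntegrableOn f Ω) :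
    ∑ s ∈ T.elements, ∫ x in A s ∩ Ω, f x =
      ∫ x in Ω, (∑ s ∈ T.elements, (A s).indicator (fun _ => (1 : ℝ)) x) * f x := by
  simp_rw [Finset.sum_mul]
  have hind : ∀ s x, (A s).indicator (fun _ => (1 : ℝ)) x * f x = (A s).indicator f x := by
    intro s x
    by_cases hx : x ∈ A s <;> simp [hx]
  simp_rw [hind]
  rw [integral_finsetSum _ fun s _ => hf.indicator (hA s)]
  refine Finset.sum_congr rfl fun s _ => ?_
  rw [integral_indicator (hA s), Measure.restrict_restrict (hA s)]

lemma sum_setIntegral_patch_le {Ω : Set (Rd d)} (T : Mesh Ω) {f : Rd d → ℝ}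
    (hf : IntegrableOn f Ω) (h0 : ∀ x, 0 ≤ f x) :
    ∑ s ∈ T.elements, ∫ x in T.patch s ∩ Ω, f x ≤ T.overlap * ∫ x in Ω, f x := by
  rw [T.sum_setIntegral_eq T.measurableSet_patch hf, ← integral_const_mul]
  refine integral_mono_of_nonneg (Filter.Eventually.of_forall fun x => ?_) (hf.const_mul _) ?_
  · exact mul_nonneg (Finset.sum_nonneg fun s _ => indicator_nonneg (by simp) _) (h0 x)
  · filter_upwards [ae_restrict_of_ae T.ae_card_patch_le] with x hx
    exact mul_le_mul_of_nonneg_right hx (h0 x)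

lemma setIntegral_le_sum_simplex {Ω : Set (Rd d)} (T : Mesh Ω) (hΩ : MeasurableSet Ω)
    {f : Rd d → ℝ} (hf : IntegrableOn f Ω) (h0 : ∀ x, 0 ≤ f x) :
    ∫ x in Ω, f x ≤ ∑ s ∈ T.elements, ∫ x in simplex s ∩ Ω, f x := by
  rw [T.sum_setIntegral_eq measurableSet_simplex hf]
  refine integral_mono_of_nonneg (Filter.Eventually.of_forall h0) ?_ ?_
  · simp_rw [Finset.sum_mul]
    refine integrable_finsetSum _ fun s _ => ?_
    refine (hf.indicator (measurableSet_simplex s)).congr (Filter.Eventually.of_forall fun x => ?_)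
    by_cases hx : x ∈ simplex s <;> simp [hx]
  · filter_upwards [ae_restrict_mem hΩ] with x hx
    have hc : x ∈ ⋃ s ∈ T.elements, convexHull ℝ (s : Set (Rd d)) := by
      rw [T.cover]
      exact subset_closure hx
    obtain ⟨s, hs, hxs⟩ := mem_iUnion₂.mp hc
    have h1 : (1 : ℝ) ≤ ∑ s ∈ T.elements, (simplex s).indicator (fun _ => (1 : ℝ)) x := by
      have hle := Finset.single_le_sum (f := fun s => (simplex s).indicator (fun _ => (1 : ℝ)) x)
        (fun s _ => indicator_nonneg (by simp) x) hs
      have hxs' : x ∈ simplex s := hxs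
      simpa [hxs'] using hle
    exact le_mul_of_one_le_left (h0 x) h1

lemma diam_simplex_le_size {Ω : Set (Rd d)} (T : Mesh Ω) {s : Finset (Rd d)}
    (hs : s ∈ T.elements) : Metric.diam (simplex s) ≤ T.size :=
  le_ciSup (f := fun s : T.elements => Metric.diam (simplex s.1)) (Set.finite_range _).bddAbove
    ⟨s, hs⟩

/-- For `d ≥ 1` an element has two distinct vertices. Positivity matters because a zero diameter
would make the weight `H_s⁻¹` zero by convention and lose the `L²` term. -/
lemma diam_simplex_pos (hd : 1 ≤ d) {Ω : Set (Rd d)} (T : Mesh Ω) {s : Finset (Rd d)}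
    (hs : s ∈ T.elements) : 0 < Metric.diam (simplex s) := by
  obtain ⟨a, ha, b, hb, hab⟩ := Finset.one_lt_card.mp (by rw [T.card_eq s hs]; omega)
  refine (dist_pos.mpr hab).trans_le (Metric.dist_le_diam_of_mem (isCompact_simplex s).isBounded
    (subset_convexHull ℝ _ ha) (subset_convexHull ℝ _ hb))

end Mesh

/-! ### The `L²` estimate on the kernel of the interpolation -/

lemma integrable_norm_sq {F : Type} [NormedAddCommGroup F] {Ω : Set (Rd d)}
    (f : Lp F 2 ((volume : Measure (Rd d)).restrict Ω)) :
    IntegrableOn (fun x => ‖f x‖ ^ 2) Ω :=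
  (Lp.memLp f).integrable_norm_pow (p := 2) (by norm_num)

lemma norm_sq_eq_integral {F : Type} [NormedAddCommGroup F] [InnerProductSpace ℂ F]
    {X : Type} [MeasurableSpace X] {μ : Measure X} (f : Lp F 2 μ) :
    ‖f‖ ^ 2 = ∫ x, ‖f x‖ ^ 2 ∂μ := by
  have h := inner_self_eq_norm_sq (𝕜 := ℂ) f
  rw [L2.inner_def] at h
  simp_rw [inner_self_eq_norm_sq_to_K (𝕜 := ℂ)] at h
  rw [← h]
  have : ∀ x, ((RCLike.ofReal ‖f x‖ : ℂ) ^ 2) = ((‖f x‖ ^ 2 : ℝ) : ℂ) := fun x => by simp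
  simp_rw [this, integral_complex_ofReal]
  simp

namespace Mesh

/-- Under the resolution condition, the `L²`-part of `‖·‖_V` is controlled by the gradient
on the kernel of the interpolation operator. -/
lemma kappa_norm_fn_sq_le (hd : 1 ≤ d) {Ω ΓD ΓR : Set (Rd d)} (hΩ : MeasurableSet Ω)
    {κ : ℝ} (hκ : 0 < κ) (T : Mesh Ω)
    {CI : ℝ} (hCI : 0 < CI) (hI : T.IsInterpolationConstant ΓD ΓR CI)
    (hres : T.size * κ ≤ 1 / (√(2 * (T.overlap : ℝ)) * CI))
    {w : V Ω ΓD ΓR} (hw : w ∈ T.W ΓD ΓR) :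
    κ ^ 2 * ‖fn w‖ ^ 2 ≤ 1 / 2 * ‖grad w‖ ^ 2 := by
  have hH : 0 ≤ T.size := Real.iSup_nonneg fun s => Metric.diam_nonneg
  have hw' : ∀ᵐ x ∂((volume : Measure (Rd d)).restrict Ω), T.interp w x = 0 := hw
  have hloc : ∀ s ∈ T.elements, ∫ x in simplex s ∩ Ω, ‖fn w x‖ ^ 2 ≤
      (T.size * CI) ^ 2 * ∫ x in T.patch s ∩ Ω, ‖grad w x‖ ^ 2 := by
    intro s hs
    have hpos := diam_simplex_pos hd T hs
    have h := hI w s hs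
    -- The gradient error is simply discarded, so only its nonnegativity is used.
    have h2 : 0 ≤ normOn Ω (simplex s) (fun x => grad w x - cgrad (T.interp w) x) :=
      Real.sqrt_nonneg _
    have heq : normOn Ω (simplex s) (fun x => fn w x - T.interp w x) =
        √(∫ x in simplex s ∩ Ω, ‖fn w x‖ ^ 2) := by
      unfold normOn
      congr 1
      refine integral_congr_ae ?_
      filter_upwards [ae_restrict_of_ae_restrict_of_subset inter_subset_right hw'] with x hx
      rw [hx, sub_zero]
    rw [heq] at h
    have h3 : √(∫ x in simplex s ∩ Ω, ‖fn w x‖ ^ 2) ≤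
        T.size * CI * √(∫ x in T.patch s ∩ Ω, ‖grad w x‖ ^ 2) := by
      have h4 : (Metric.diam (simplex s))⁻¹ * √(∫ x in simplex s ∩ Ω, ‖fn w x‖ ^ 2) ≤
          CI * √(∫ x in T.patch s ∩ Ω, ‖grad w x‖ ^ 2) := by
        refine le_trans ?_ h
        linarith
      rw [inv_mul_le_iff₀ hpos] at h4
      refine h4.trans ?_
      rw [mul_assoc]
      exact mul_le_mul_of_nonneg_right (diam_simplex_le_size T hs) (by positivity)
    have i1 : 0 ≤ ∫ x in simplex s ∩ Ω, ‖fn w x‖ ^ 2 := integral_nonneg fun x => by positivity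
    have i2 : 0 ≤ ∫ x in T.patch s ∩ Ω, ‖grad w x‖ ^ 2 := integral_nonneg fun x => by positivity
    calc _ = √(∫ x in simplex s ∩ Ω, ‖fn w x‖ ^ 2) ^ 2 := (Real.sq_sqrt i1).symm
      _ ≤ (T.size * CI * √(∫ x in T.patch s ∩ Ω, ‖grad w x‖ ^ 2)) ^ 2 := by gcongr
      _ = _ := by rw [mul_pow, Real.sq_sqrt i2]
  have hsum : ‖fn w‖ ^ 2 ≤ (T.size * CI) ^ 2 * (T.overlap * ‖grad w‖ ^ 2) := by
    rw [norm_sq_eq_integral (fn w), norm_sq_eq_integral (grad w)]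
    refine (T.setIntegral_le_sum_simplex hΩ (integrable_norm_sq _) fun x => by positivity).trans ?_
    refine (Finset.sum_le_sum hloc).trans ?_
    rw [← Finset.mul_sum]
    exact mul_le_mul_of_nonneg_left
      (T.sum_setIntegral_patch_le (integrable_norm_sq _) fun x => by positivity) (by positivity)
  have hq : T.size * κ * (√(2 * (T.overlap : ℝ)) * CI) ≤ 1 := by
    -- If the overlap is `0`, the quotient in the resolution condition is `1 / 0`; the product is
    -- then zero and the bound is trivial.
    rcases (by positivity : 0 ≤ √(2 * (T.overlap : ℝ)) * CI).eq_or_lt with h0 | h0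
    · rw [← h0, mul_zero]
      exact zero_le_one
    · exact (le_div_iff₀ h0).mp hres
  have hq2 : (T.size * κ * (√(2 * (T.overlap : ℝ)) * CI)) ^ 2 ≤ 1 :=
    pow_le_one₀ (by positivity) hq
  rw [mul_pow, mul_pow (√_), Real.sq_sqrt (by positivity)] at hq2
  calc κ ^ 2 * ‖fn w‖ ^ 2 ≤ κ ^ 2 * ((T.size * CI) ^ 2 * (T.overlap * ‖grad w‖ ^ 2)) := by gcongr
    _ = ((T.size * κ) ^ 2 * (2 * T.overlap * CI ^ 2)) * (1 / 2 * ‖grad w‖ ^ 2) := by ring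
    _ ≤ 1 * (1 / 2 * ‖grad w‖ ^ 2) := by gcongr
    _ = _ := one_mul _

end Mesh

/-! ### Closedness of `V` and `W` -/

lemma continuous_integral_mul {X : Type} [MeasurableSpace X] {μ : Measure X} {h : X → ℂ}
    (hh : MemLp h 2 μ) : Continuous fun u : Lp ℂ 2 μ => ∫ x, u x * h x ∂μ := by
  have hs : MemLp (fun x => conj (h x)) 2 μ := hh.star
  have he : (fun u : Lp ℂ 2 μ => ∫ x, u x * h x ∂μ) = fun u => inner ℂ (hs.toLp _) u := by
    funext u
    rw [L2.inner_def]
    refine integral_congr_ae ?_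
    filter_upwards [hs.coeFn_toLp] with x hx
    rw [hx, RCLike.inner_apply, Complex.conj_conj]
  rw [he]
  fun_prop

/-- For a fixed test function and index, both sides of the defining identity are `L²` pairings with
a fixed function, hence continuous in the pair. -/
lemma isClosed_setOf_isWeakGradient (Ω : Set (Rd d)) :
    IsClosed {p : L2 Ω × L2vec Ω | IsWeakGradient Ω p.1 p.2} := by
  simp only [IsWeakGradient, ofPred_forall]
  refine isClosed_iInter fun φ => isClosed_iInter fun hφ => isClosed_iInter fun hc =>
    isClosed_iInter fun _ => isClosed_iInter fun i => ?_
  have hmem : ∀ {ψ : Rd d → ℝ}, Continuous ψ → HasCompactSupport ψ →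
      MemLp (fun x => (ψ x : ℂ)) 2 ((volume : Measure (Rd d)).restrict Ω) := fun h1 h2 =>
    ((h1.memLp_of_hasCompactSupport (μ := volume) (p := 2) h2).restrict Ω).ofReal
  refine isClosed_eq ?_ (Continuous.neg ?_)
  · have h := (continuous_integral_mul (hmem (continuous_pderiv hφ i)
      (hasCompactSupport_pderiv hc i))).comp (continuous_fst (X := L2 Ω) (Y := L2vec Ω))
    refine h.congr fun p => integral_congr_ae (Filter.Eventually.of_forall fun x => ?_)
    simp [mul_comm]
  · have h := (continuous_integral_mul (hmem hφ.continuous hc)).comp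
      (((EuclideanSpace.proj (𝕜 := ℂ) i : Cd d →L[ℂ] ℂ).compLpL 2
        ((volume : Measure (Rd d)).restrict Ω)).continuous.comp
        (continuous_snd (X := L2 Ω) (Y := L2vec Ω)))
    refine h.congr fun p => integral_congr_ae ?_
    filter_upwards [(EuclideanSpace.proj (𝕜 := ℂ) i : Cd d →L[ℂ] ℂ).coeFn_compLpL p.2] with x hx
    simp [hx, mul_comm]

/-- `V` is a closed subspace of `L²(Ω) × L²(Ω)^d × L²(Γ_D ∪ Γ_R)`. -/
lemma isClosed_V {Ω ΓD ΓR : Set (Rd d)} (hD : MeasurableSet ΓD) :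
    IsClosed (V Ω ΓD ΓR : Set (L2 Ω × L2vec Ω × L2bdry (ΓD ∪ ΓR))) := by
  refine IsClosed.inter ?_ (IsClosed.inter ?_ ?_)
  · exact (isClosed_setOf_isWeakGradient Ω).preimage
      (continuous_fst.prodMk (continuous_fst.comp continuous_snd))
  · exact Submodule.isClosed_topologicalClosure _
  -- Vanishing almost everywhere on `ΓD` means lying in the kernel of the continuous restriction map
  -- to `ΓD`.
  · have he : {p : L2 Ω × L2vec Ω × L2bdry (ΓD ∪ ΓR) |
        ∀ᵐ x ∂((surface d).restrict (ΓD ∪ ΓR)), x ∈ ΓD → p.2.2 x = 0} =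
        {p | LpToLpRestrictCLM (Rd d) ℂ ℂ ((surface d).restrict (ΓD ∪ ΓR)) 2 ΓD p.2.2 = 0} := by
      ext p
      rw [mem_ofPred_eq, mem_ofPred_eq, ← ae_restrict_iff' hD, Lp.eq_zero_iff_ae_eq_zero]
      have hr := LpToLpRestrictCLM_coeFn (p := 2) (μ := (surface d).restrict (ΓD ∪ ΓR)) ℂ ΓD p.2.2
      exact ⟨fun h => hr.trans h, fun h => hr.symm.trans h⟩
    change IsClosed {p : L2 Ω × L2vec Ω × L2bdry (ΓD ∪ ΓR) |
        ∀ᵐ x ∂((surface d).restrict (ΓD ∪ ΓR)), x ∈ ΓD → p.2.2 x = 0}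
    rw [he]
    exact isClosed_eq (by fun_prop) continuous_const

namespace Mesh

lemma continuous_nodal {Ω ΓD ΓR : Set (Rd d)} (T : Mesh Ω) (z : Rd d) :
    Continuous fun v : V Ω ΓD ΓR => T.nodal z v :=
  ((continuous_integral_mul (T.memLp_hat z)).comp
    (continuous_fst.comp continuous_subtype_val)).div_const _

/-- At each fixed `x` the interpolant is a finite combination of continuous functionals of `v`.
Along a sequence the countably many exceptional null sets have null union, so the limit can be taken
pointwise. -/
lemma isClosed_W {Ω ΓD ΓR : Set (Rd d)} (T : Mesh Ω) :
    IsClosed (T.W ΓD ΓR : Set (V Ω ΓD ΓR)) := by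
  refine IsSeqClosed.isClosed fun v w hv hvw => ?_
  have h : ∀ᵐ x ∂((volume : Measure (Rd d)).restrict Ω), ∀ n, T.interp (v n) x = 0 :=
    ae_all_iff.mpr hv
  change ∀ᵐ x ∂((volume : Measure (Rd d)).restrict Ω), T.interp w x = 0
  filter_upwards [h] with x hx
  have hc : Continuous fun v : V Ω ΓD ΓR => T.interp v x :=
    continuous_finsetSum _ fun z _ => (T.continuous_nodal z).mul continuous_const
  refine tendsto_nhds_unique ((hc.tendsto w).comp hvw) ?_
  refine tendsto_const_nhds.congr fun n => ?_
  exact (hx n).symm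

end Mesh

/-! ### The Helmholtz form through inner products -/

section Form

variable {Ω ΓD ΓR : Set (Rd d)}

/-- The trace is recorded on `ΓD ∪ ΓR` but vanishes on `ΓD`, so its full inner product reduces to
the Robin integral. -/
lemma form_eq_inner (hD : MeasurableSet ΓD) (hDR : Disjoint ΓD ΓR) (κ : ℝ) (u v : V Ω ΓD ΓR) :
    form κ u v = inner ℂ (grad v) (grad u) - (κ : ℂ) ^ 2 * inner ℂ (fn v) (fn u)
      - Complex.I * (κ : ℂ) * inner ℂ (tr v) (tr u) := by
  have h1 : ∫ x in Ω, ∑ i, (grad u x) i * conj ((grad v x) i) = inner ℂ (grad v) (grad u) := by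
    rw [L2.inner_def]
    refine integral_congr_ae (Filter.Eventually.of_forall fun x => ?_)
    simp [PiLp.inner_apply]
  have h2 : ∫ x in Ω, fn u x * conj (fn v x) = inner ℂ (fn v) (fn u) := by
    rw [L2.inner_def]
    refine integral_congr_ae (Filter.Eventually.of_forall fun x => ?_)
    simp
  have h3 : ∫ x in ΓR, tr u x * conj (tr v x) ∂(surface d) = inner ℂ (tr v) (tr u) := by
    have hz : ∀ᵐ x ∂((surface d).restrict (ΓD ∪ ΓR)),
        inner ℂ (tr v x) (tr u x) = ΓDᶜ.indicator (fun x => tr u x * conj (tr v x)) x := by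
      filter_upwards [u.2.2.2] with x hx
      by_cases h : x ∈ ΓD
      · have : tr u x = 0 := hx h
        simp [h, this]
      · simp [h]
    have hset : ΓDᶜ ∩ (ΓD ∪ ΓR) = ΓR := by
      rw [inter_union_distrib_left, compl_inter_self, empty_union]
      exact inter_eq_right.mpr hDR.symm.subset_compl_right
    rw [L2.inner_def, integral_congr_ae hz, integral_indicator hD.compl,
      Measure.restrict_restrict hD.compl, hset]
  rw [form, h1, h2, h3]

lemma form_self_re (hD : MeasurableSet ΓD) (hDR : Disjoint ΓD ΓR) (κ : ℝ) (u : V Ω ΓD ΓR) :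
    (form κ u u).re = ‖grad u‖ ^ 2 - κ ^ 2 * ‖fn u‖ ^ 2 := by
  rw [form_eq_inner hD hDR]
  simp only [inner_self_eq_norm_sq_to_K]
  simp [← Complex.ofReal_pow]

lemma form_self_im (hD : MeasurableSet ΓD) (hDR : Disjoint ΓD ΓR) (κ : ℝ) (u : V Ω ΓD ΓR) :
    (form κ u u).im = -(κ * ‖tr u‖ ^ 2) := by
  rw [form_eq_inner hD hDR]
  simp only [inner_self_eq_norm_sq_to_K]
  simp [← Complex.ofReal_pow]

lemma normV_nonneg (κ : ℝ) (v : V Ω ΓD ΓR) : 0 ≤ normV κ v := Real.sqrt_nonneg _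

lemma normV_sq (κ : ℝ) (v : V Ω ΓD ΓR) :
    normV κ v ^ 2 = κ ^ 2 * ‖fn v‖ ^ 2 + ‖grad v‖ ^ 2 := Real.sq_sqrt (by positivity)

/-- The continuity of the form controls the trace by `‖·‖_V`. -/
lemma kappa_norm_tr_sq_le (hD : MeasurableSet ΓD) (hDR : Disjoint ΓD ΓR) {κ Ca : ℝ}
    (hCa : IsContinuityConstant Ω ΓD ΓR κ Ca) (v : V Ω ΓD ΓR) :
    κ * ‖tr v‖ ^ 2 ≤ Ca * normV κ v ^ 2 := by
  have h := (Complex.abs_im_le_norm (form κ v v)).trans (hCa v v)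
  rw [form_self_im hD hDR, abs_neg] at h
  calc _ ≤ _ := le_abs_self _
    _ ≤ _ := h
    _ = _ := by ring

end Form

/-! ### Complex conjugation on `V` and `W` -/

/-- Pointwise complex conjugation on `L²`. -/
def conjLp {X : Type} [MeasurableSpace X] (μ : Measure X) : Lp ℂ 2 μ →L⋆[ℂ] Lp ℂ 2 μ :=
  ((starL ℂ : ℂ ≃L⋆[ℂ] ℂ) : ℂ →L⋆[ℂ] ℂ).compLpL 2 μ

lemma coeFn_conjLp {X : Type} [MeasurableSpace X] {μ : Measure X} (f : Lp ℂ 2 μ) :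
    conjLp μ f =ᵐ[μ] fun x => conj (f x) :=
  ((starL ℂ : ℂ ≃L⋆[ℂ] ℂ) : ℂ →L⋆[ℂ] ℂ).coeFn_compLpL f

/-- Componentwise complex conjugation on `ℂ^d`. -/
def conjCd (d : ℕ) : Cd d →L⋆[ℂ] Cd d where
  toFun x := WithLp.toLp 2 fun i => conj (x i)
  map_add' x y := by ext i; simp
  map_smul' c x := by ext i; simp
  cont := by fun_prop

@[simp]
lemma conjCd_apply (x : Cd d) (i : Fin d) : conjCd d x i = conj (x i) := rfl

/-- Pointwise complex conjugation of the triple of a function, its gradient and its trace. -/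
def conjTriple {Ω S : Set (Rd d)} (p : L2 Ω × L2vec Ω × L2bdry S) : L2 Ω × L2vec Ω × L2bdry S :=
  (conjLp _ p.1, (conjCd d).compLpL 2 _ p.2.1, conjLp _ p.2.2)

lemma continuous_conjTriple {Ω S : Set (Rd d)} :
    Continuous (conjTriple : L2 Ω × L2vec Ω × L2bdry S → L2 Ω × L2vec Ω × L2bdry S) := by
  unfold conjTriple
  fun_prop

lemma cgrad_conj {φ : Rd d → ℂ} (hφ : Differentiable ℝ φ) (x : Rd d) :
    cgrad (fun y => conj (φ y)) x = conjCd d (cgrad φ x) := by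
  ext i
  have h : HasFDerivAt (fun y => conj (φ y))
      ((Complex.conjCLE : ℂ →L[ℝ] ℂ).comp (fderiv ℝ φ x)) x :=
    (Complex.conjCLE : ℂ →L[ℝ] ℂ).hasFDerivAt.comp x (hφ x).hasFDerivAt
  simp [cgrad, pderiv, h.fderiv]

/-- Conjugation is continuous and sends triples of smooth functions to such triples, so it preserves
their closure. -/
lemma conjTriple_mem_traceGraph {Ω S : Set (Rd d)} {p : L2 Ω × L2vec Ω × L2bdry S}
    (hp : p ∈ traceGraph Ω S) : conjTriple p ∈ traceGraph Ω S := by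
  refine map_mem_closure continuous_conjTriple hp ?_
  rintro q ⟨φ, hφ, h1, h2, h3⟩
  refine ⟨fun y => conj (φ y), Complex.conjCLE.contDiff.comp hφ, ?_, ?_, ?_⟩
  · filter_upwards [coeFn_conjLp q.1, h1] with x hx h
    rw [conjTriple, hx, h]
  · filter_upwards [(conjCd d).coeFn_compLpL q.2.1, h2] with x hx h
    rw [conjTriple, hx, h, cgrad_conj (hφ.differentiable (by simp))]
  · filter_upwards [coeFn_conjLp q.2.2, h3] with x hx h
    rw [conjTriple, hx, h]

/-- Test functions are real, so the defining identity can be conjugated as a whole. -/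
lemma IsWeakGradient.conj {Ω : Set (Rd d)} {u : L2 Ω} {G : L2vec Ω} (h : IsWeakGradient Ω u G) :
    IsWeakGradient Ω (conjLp _ u) ((conjCd d).compLpL 2 _ G) := by
  intro φ hφ hc hs i
  have e1 : ∫ x in Ω, pderiv i φ x • (conjLp _ u) x =
      ∫ x in Ω, starRingEnd ℂ (pderiv i φ x • u x) := by
    refine integral_congr_ae ?_
    filter_upwards [coeFn_conjLp u] with x hx
    rw [hx]
    simp
  have e2 : ∫ x in Ω, φ x • ((conjCd d).compLpL 2 _ G x) i =
      ∫ x in Ω, starRingEnd ℂ (φ x • G x i) := by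
    refine integral_congr_ae ?_
    filter_upwards [(conjCd d).coeFn_compLpL G] with x hx
    rw [hx]
    simp
  rw [e1, e2, integral_conj, integral_conj, h φ hφ hc hs i, map_neg]

section Conjugation

variable {Ω ΓD ΓR : Set (Rd d)}

lemma exists_isConj (v : V Ω ΓD ΓR) : ∃ v' : V Ω ΓD ΓR, IsConj v v' := by
  obtain ⟨p, h1, h2, h3⟩ := v
  refine ⟨⟨conjTriple p, h1.conj, conjTriple_mem_traceGraph h2, ?_⟩, ?_, ?_, ?_⟩
  · filter_upwards [coeFn_conjLp p.2.2, h3] with x hx h hD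
    rw [conjTriple, hx, h hD, map_zero]
  · exact coeFn_conjLp p.1
  · filter_upwards [(conjCd d).coeFn_compLpL p.2.1] with x hx i
    change ((conjCd d).compLpL 2 _ p.2.1 x) i = _
    rw [hx]
    rfl
  · exact coeFn_conjLp p.2.2

lemma IsConj.symm {v v' : V Ω ΓD ΓR} (h : IsConj v v') : IsConj v' v := by
  obtain ⟨h1, h2, h3⟩ := h
  refine ⟨?_, ?_, ?_⟩
  · filter_upwards [h1] with x hx
    rw [hx, Complex.conj_conj]
  · filter_upwards [h2] with x hx i
    rw [hx, Complex.conj_conj]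
  · filter_upwards [h3] with x hx
    rw [hx, Complex.conj_conj]

/-- In each integrand conjugating both factors swaps them, while the coefficients, including `-iκ`,
stay unconjugated. This turns the dual problem into the primal one for conjugated data. -/
lemma IsConj.form_eq {u u' v v' : V Ω ΓD ΓR} (hu : IsConj u u') (hv : IsConj v v') (κ : ℝ) :
    form κ u' v' = form κ v u := by
  unfold form
  congr 1
  · congr 1
    · refine integral_congr_ae ?_
      filter_upwards [hu.2.1, hv.2.1] with x h k
      simp [h, k, mul_comm]
    · congr 1
      refine integral_congr_ae ?_
      filter_upwards [hu.1, hv.1] with x h k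
      simp [h, k, mul_comm]
  · congr 1
    refine integral_congr_ae ?_
    filter_upwards [ae_restrict_of_ae_restrict_of_subset subset_union_right hu.2.2,
      ae_restrict_of_ae_restrict_of_subset subset_union_right hv.2.2] with x h k
    simp [h, k, mul_comm]

lemma IsConj.normV_eq {v v' : V Ω ΓD ΓR} (h : IsConj v v') (κ : ℝ) :
    normV κ v' = normV κ v := by
  have h1 : ‖fn v'‖ = ‖fn v‖ := by
    rw [Lp.norm_def, Lp.norm_def]
    refine congrArg ENNReal.toReal (eLpNorm_congr_norm_ae ?_)
    filter_upwards [h.1] with x hx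
    rw [hx, RCLike.norm_conj]
  have h2 : ‖grad v'‖ = ‖grad v‖ := by
    rw [Lp.norm_def, Lp.norm_def]
    refine congrArg ENNReal.toReal (eLpNorm_congr_norm_ae ?_)
    filter_upwards [h.2.1] with x hx
    simp [EuclideanSpace.norm_eq, hx]
  rw [normV, normV, h1, h2]

/-- The hat functions are real, so nodal values and interpolants commute with conjugation. -/
lemma Mesh.mem_W_of_isConj (T : Mesh Ω) {v v' : V Ω ΓD ΓR} (h : IsConj v v')
    (hv : v ∈ T.W ΓD ΓR) : v' ∈ T.W ΓD ΓR := by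
  have hn : ∀ z, T.nodal z v' = conj (T.nodal z v) := by
    intro z
    rw [nodal, nodal, map_div₀, ← integral_conj, ← integral_conj]
    congr 1
    · refine integral_congr_ae ?_
      filter_upwards [h.1] with x hx
      simp [hx]
    · simp
  have hv' : ∀ᵐ x ∂((volume : Measure (Rd d)).restrict Ω), T.interp v x = 0 := hv
  change ∀ᵐ x ∂((volume : Measure (Rd d)).restrict Ω), T.interp v' x = 0
  filter_upwards [hv'] with x hx
  have hi : T.interp v' x = conj (T.interp v x) := by simp [interp, hn]
  rw [hi, hx, map_zero]

end Conjugation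

/-! ### Lax–Milgram and the Hilbert space of triples -/

/-- The **Lax–Milgram theorem** for the form `(u, w) ↦ ⟪J w, A (J u)⟫`, coercive on `N`. -/
lemma exists_linearMap_inner_eq {M E : Type*} [AddCommGroup M] [Module ℂ M]
    [NormedAddCommGroup E] [InnerProductSpace ℂ E] [CompleteSpace E] (J : M →ₗ[ℂ] E)
    (hJ : Function.Injective J) (N : Submodule ℂ M) (hN : IsClosed (N.map J : Set E))
    (A : E →L[ℂ] E) {c : ℝ} (hc : 0 < c)
    (hA : ∀ w ∈ N, c * ‖J w‖ ^ 2 ≤ (inner ℂ (J w) (A (J w))).re) :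
    ∃ C : M →ₗ[ℂ] N, ∀ v, ∀ w ∈ N, inner ℂ (J w) (A (J (C v))) = inner ℂ (J w) (A (J v)) := by
  have : CompleteSpace (N.map J) := hN.completeSpace_coe
  have hP : ∀ (w : N.map J) (x : E),
      inner ℂ w ((N.map J).orthogonalProjectionOnto x) = inner ℂ (w : E) x := fun w x =>
    (N.map J).inner_orthogonalProjectionOnto_eq_of_mem_left w x
  -- The compression of `A` to the closed subspace `J(N)`. Coercivity makes it invertible, and the
  -- solution map `J⁻¹ B⁻¹ P A J`, with `P` the orthogonal projection, is linear by construction.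
  let B : N.map J →L[ℂ] N.map J := (N.map J).orthogonalProjectionOnto ∘L A ∘L (N.map J).subtypeL
  have hB : IsUnit B := by
    refine ContinuousLinearMap.isUnit_of_forall_le_norm_inner_map B (c := ⟨c, hc.le⟩) hc ?_
    rintro ⟨_, w, hw, rfl⟩
    rw [norm_inner_symm]
    refine le_trans ?_ (Complex.re_le_norm _)
    change ‖J w‖ ^ 2 * c ≤ (inner ℂ _ ((N.map J).orthogonalProjectionOnto (A (J w)))).re
    rw [hP, mul_comm]
    exact hA w hw
  obtain ⟨U, hU⟩ := hB
  let e := N.equivMapOfInjective J hJ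
  let C : M →ₗ[ℂ] N := e.symm.toLinearMap ∘ₗ (U⁻¹).1.toLinearMap ∘ₗ
    (N.map J).orthogonalProjectionOnto.toLinearMap ∘ₗ A.toLinearMap ∘ₗ J
  refine ⟨C, fun v w hw => ?_⟩
  have hJC : J (C v) = ((U⁻¹).1 ((N.map J).orthogonalProjectionOnto (A (J v))) : N.map J) := by
    change ((e (e.symm _) : N.map J) : E) = _
    rw [e.apply_symm_apply]
    rfl
  have hBU : ∀ x, (N.map J).orthogonalProjectionOnto (A ((U⁻¹).1 x : N.map J)) = x := by
    intro x
    change B ((U⁻¹).1 x) = x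
    rw [← hU]
    exact DFunLike.congr_fun U.mul_inv x
  rw [hJC, ← hP ⟨J w, w, hw, rfl⟩, hBU, hP]

/-- The Hilbert space `L²(Ω) ⊕ L²(Ω)^d ⊕ L²(S)`. -/
abbrev Hilb (Ω S : Set (Rd d)) : Type := WithLp 2 (L2 Ω × WithLp 2 (L2vec Ω × L2bdry S))

/-- The Hilbert space norm on triples of a function, its gradient and its trace. -/
def toHilb (Ω S : Set (Rd d)) : (L2 Ω × L2vec Ω × L2bdry S) ≃L[ℂ] Hilb Ω S :=
  ((ContinuousLinearEquiv.refl ℂ (L2 Ω)).prodCongr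
    (WithLp.prodContinuousLinearEquiv 2 ℂ (L2vec Ω) (L2bdry S)).symm).trans
    (WithLp.prodContinuousLinearEquiv 2 ℂ (L2 Ω) (WithLp 2 (L2vec Ω × L2bdry S))).symm

lemma inner_toHilb {Ω S : Set (Rd d)} (p q : L2 Ω × L2vec Ω × L2bdry S) :
    inner ℂ (toHilb Ω S p) (toHilb Ω S q) =
      inner ℂ p.1 q.1 + (inner ℂ p.2.1 q.2.1 + inner ℂ p.2.2 q.2.2) := by
  rw [WithLp.prod_inner_apply, WithLp.prod_inner_apply]
  rfl

/-- The operator `diag(-κ², 1, -iκ)`, which represents the Helmholtz form. -/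
def helmholtzOp (Ω S : Set (Rd d)) (κ : ℝ) : Hilb Ω S →L[ℂ] Hilb Ω S :=
  (toHilb Ω S : _ →L[ℂ] Hilb Ω S) ∘L
    ((-(κ : ℂ) ^ 2 • ContinuousLinearMap.id ℂ (L2 Ω)).prodMap
      ((ContinuousLinearMap.id ℂ (L2vec Ω)).prodMap
        (-(Complex.I * κ) • ContinuousLinearMap.id ℂ (L2bdry S)))) ∘L
    ((toHilb Ω S).symm : Hilb Ω S →L[ℂ] _)

section Form

variable {Ω ΓD ΓR : Set (Rd d)}

/-- The embedding of `V` into `L²(Ω) ⊕ L²(Ω)^d ⊕ L²(Γ_D ∪ Γ_R)`. -/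
def embed (Ω ΓD ΓR : Set (Rd d)) : V Ω ΓD ΓR →ₗ[ℂ] Hilb Ω (ΓD ∪ ΓR) :=
  (toHilb Ω (ΓD ∪ ΓR)).toLinearMap ∘ₗ (V Ω ΓD ΓR).subtype

lemma embed_injective : Function.Injective (embed Ω ΓD ΓR) :=
  (toHilb Ω (ΓD ∪ ΓR)).injective.comp Subtype.val_injective

lemma norm_embed_sq (v : V Ω ΓD ΓR) :
    ‖embed Ω ΓD ΓR v‖ ^ 2 = ‖fn v‖ ^ 2 + (‖grad v‖ ^ 2 + ‖tr v‖ ^ 2) := by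
  rw [WithLp.prod_norm_sq_eq_of_L2, WithLp.prod_norm_sq_eq_of_L2]
  rfl

lemma form_eq_inner_helmholtzOp (hD : MeasurableSet ΓD) (hDR : Disjoint ΓD ΓR) (κ : ℝ)
    (u v : V Ω ΓD ΓR) :
    form κ u v = inner ℂ (embed Ω ΓD ΓR v) (helmholtzOp Ω (ΓD ∪ ΓR) κ (embed Ω ΓD ΓR u)) := by
  have h : helmholtzOp Ω (ΓD ∪ ΓR) κ (embed Ω ΓD ΓR u) = toHilb Ω (ΓD ∪ ΓR)
      (-(κ : ℂ) ^ 2 • fn u, grad u, -(Complex.I * κ) • tr u) := by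
    simp only [helmholtzOp, embed, ContinuousLinearMap.comp_apply, LinearMap.comp_apply,
      ContinuousLinearEquiv.coe_coe, ContinuousLinearEquiv.coe_toLinearEquiv,
      LinearEquiv.coe_coe, ContinuousLinearEquiv.symm_apply_apply]
    rfl
  rw [h, form_eq_inner hD hDR]
  change _ = inner ℂ (toHilb Ω (ΓD ∪ ΓR) (fn v, grad v, tr v)) _
  rw [inner_toHilb, inner_smul_right, inner_smul_right]
  ring

lemma form_sub_left (hD : MeasurableSet ΓD) (hDR : Disjoint ΓD ΓR) (κ : ℝ)
    (u u' v : V Ω ΓD ΓR) : form κ (u - u') v = form κ u v - form κ u' v := by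
  simp only [form_eq_inner_helmholtzOp hD hDR, map_sub, inner_sub_right]

lemma form_sub_right (hD : MeasurableSet ΓD) (hDR : Disjoint ΓD ΓR) (κ : ℝ)
    (u v v' : V Ω ΓD ΓR) : form κ u (v - v') = form κ u v - form κ u v' := by
  simp only [form_eq_inner_helmholtzOp hD hDR, map_sub, inner_sub_left]

/-- The three summands of the constant bound the function, its gradient and its trace. This upgrades
coercivity in `‖·‖_V` to coercivity in the Hilbert norm; `|Ca|` appears because the sign of `Ca` is
not assumed. -/
lemma norm_embed_sq_le (hD : MeasurableSet ΓD) (hDR : Disjoint ΓD ΓR) {κ Ca : ℝ} (hκ : 0 < κ)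
    (hCa : IsContinuityConstant Ω ΓD ΓR κ Ca) (v : V Ω ΓD ΓR) :
    ‖embed Ω ΓD ΓR v‖ ^ 2 ≤ ((κ ^ 2)⁻¹ + 1 + |Ca| / κ) * normV κ v ^ 2 := by
  have h1 : ‖fn v‖ ^ 2 ≤ (κ ^ 2)⁻¹ * normV κ v ^ 2 := by
    rw [le_inv_mul_iff₀ (by positivity), normV_sq]
    linarith [sq_nonneg ‖grad v‖]
  have h2 : ‖grad v‖ ^ 2 ≤ normV κ v ^ 2 := by
    rw [normV_sq]
    linarith [(by positivity : 0 ≤ κ ^ 2 * ‖fn v‖ ^ 2)]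
  have h3 : ‖tr v‖ ^ 2 ≤ |Ca| / κ * normV κ v ^ 2 := by
    rw [div_mul_eq_mul_div, le_div_iff₀ hκ, mul_comm]
    exact (kappa_norm_tr_sq_le hD hDR hCa v).trans
      (mul_le_mul_of_nonneg_right (le_abs_self Ca) (sq_nonneg _))
  rw [norm_embed_sq]
  linarith

lemma eq_zero_of_normV_eq_zero (hD : MeasurableSet ΓD) (hDR : Disjoint ΓD ΓR) {κ Ca : ℝ}
    (hκ : 0 < κ) (hCa : IsContinuityConstant Ω ΓD ΓR κ Ca) {v : V Ω ΓD ΓR}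
    (hv : normV κ v = 0) : v = 0 := by
  have h := norm_embed_sq_le hD hDR hκ hCa v
  rw [hv, zero_pow two_ne_zero, mul_zero] at h
  refine embed_injective ?_
  rw [map_zero, ← norm_eq_zero]
  exact pow_eq_zero_iff two_ne_zero |>.mp (le_antisymm h (sq_nonneg _))

lemma Mesh.isClosed_map_embed_W (hD : MeasurableSet ΓD) (T : Mesh Ω) :
    IsClosed ((T.W ΓD ΓR).map (embed Ω ΓD ΓR) : Set (Hilb Ω (ΓD ∪ ΓR))) := by
  have h1 : IsClosed (Subtype.val '' (T.W ΓD ΓR : Set (V Ω ΓD ΓR))) :=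
    (isClosed_V hD).isClosedEmbedding_subtypeVal.isClosedMap _ T.isClosed_W
  have h2 := (toHilb Ω (ΓD ∪ ΓR)).toHomeomorph.isClosedMap _ h1
  rwa [image_image] at h2

/-- Quasi-optimality in a space on which the form is coercive with constant `1/3`. -/
lemma normV_le_three_mul {κ Ca : ℝ} (hCa : IsContinuityConstant Ω ΓD ΓR κ Ca)
    {c v : V Ω ΓD ΓR} (h : 1 / 3 * normV κ c ^ 2 ≤ Ca * normV κ v * normV κ c) :
    normV κ c ≤ 3 * Ca * normV κ v := by
  -- Division by `‖c‖_V` fails when it is zero. The right-hand side is then shown nonnegative by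
  -- applying continuity to `(v, v)`.
  rcases (normV_nonneg κ c).eq_or_lt with hc | hc
  · rw [← hc]
    have hv := (norm_nonneg _).trans (hCa v v)
    rcases (normV_nonneg κ v).eq_or_lt with h0 | h0
    · rw [← h0, mul_zero]
    · have : 0 ≤ Ca * normV κ v := nonneg_of_mul_nonneg_left hv h0
      linarith
  · refine le_of_mul_le_mul_right ?_ hc
    linarith

end Form

end Helmholtz

end

/-! ### Well-posedness of the correctors -/

theorem mainTheorem8 (d : ℕ) (hd : 1 ≤ d ∧ d ≤ 3)
    (Ω ΓD ΓN ΓR : Set (Helmholtz.Rd d))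
    (hΩ : Helmholtz.IsLipschitzDomain Ω)
    (hΓ : Helmholtz.IsBoundaryPartition Ω ΓD ΓN ΓR)
    (κ : ℝ) (hκ : 0 < κ)
    (T : Helmholtz.Mesh Ω)
    (CI : ℝ) (hCI : 0 < CI) (hI : T.IsInterpolationConstant ΓD ΓR CI)
    (Ca : ℝ) (hCa : Helmholtz.IsContinuityConstant Ω ΓD ΓR κ Ca)
    (hres : T.size * κ ≤ 1 / (√(2 * (T.overlap : ℝ)) * CI)) :
    (∀ w ∈ T.W ΓD ΓR, ‖Helmholtz.grad w‖ ≤ Helmholtz.normV κ w ∧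
      Helmholtz.normV κ w ≤ √(3 / 2) * ‖Helmholtz.grad w‖) ∧
    (∀ w ∈ T.W ΓD ΓR, 1 / 3 * Helmholtz.normV κ w ^ 2 ≤ (Helmholtz.form κ w w).re) ∧
    ∃ C Cs : Helmholtz.V Ω ΓD ΓR →ₗ[ℂ] T.W ΓD ΓR,
      (∀ (v : Helmholtz.V Ω ΓD ΓR) (c : T.W ΓD ΓR),
        (∀ w ∈ T.W ΓD ΓR, Helmholtz.form κ c.1 w = Helmholtz.form κ v w) ↔ c = C v) ∧
      (∀ (v : Helmholtz.V Ω ΓD ΓR) (c : T.W ΓD ΓR),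
        (∀ w ∈ T.W ΓD ΓR, Helmholtz.form κ w c.1 = Helmholtz.form κ w v) ↔ c = Cs v) ∧
      (∀ v : Helmholtz.V Ω ΓD ΓR,
        Helmholtz.normV κ (C v).1 ≤ 3 * Ca * Helmholtz.normV κ v ∧
        Helmholtz.normV κ (Cs v).1 ≤ 3 * Ca * Helmholtz.normV κ v) ∧
      (∀ v : Helmholtz.V Ω ΓD ΓR, ∃ v' : Helmholtz.V Ω ΓD ΓR, Helmholtz.IsConj v v' ∧
        Helmholtz.IsConj (C v').1 (Cs v).1 ∧
        Helmholtz.normV κ (Cs v).1 = Helmholtz.normV κ (C v').1) := by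
  have hD := hΓ.measurableSet_dirichlet
  have hDR := hΓ.disjoint_dirichlet_robin
  have hfn : ∀ w ∈ T.W ΓD ΓR,
      κ ^ 2 * ‖Helmholtz.fn w‖ ^ 2 ≤ 1 / 2 * ‖Helmholtz.grad w‖ ^ 2 := fun w hw =>
    T.kappa_norm_fn_sq_le hd.1 hΩ.isOpen.measurableSet hκ hCI hI hres hw
  have hcoer : ∀ w ∈ T.W ΓD ΓR,
      1 / 3 * Helmholtz.normV κ w ^ 2 ≤ (Helmholtz.form κ w w).re := by
    intro w hw
    rw [Helmholtz.form_self_re hD hDR, Helmholtz.normV_sq]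
    -- The constant `1/3` is exactly what `κ² ‖w‖² ≤ ½ ‖∇w‖²` allows: the claim rearranges to `4/3
    -- κ² ‖w‖² ≤ 2/3 ‖∇w‖²`.
    linarith [hfn w hw]
  refine ⟨fun w hw => ⟨?_, ?_⟩, hcoer, ?_⟩
  · exact Real.le_sqrt_of_sq_le (le_add_of_nonneg_left (by positivity))
  · rw [Helmholtz.normV, Real.sqrt_le_left (by positivity), mul_pow, Real.sq_sqrt (by norm_num)]
    linarith [hfn w hw]
  let J := Helmholtz.embed Ω ΓD ΓR
  let A := Helmholtz.helmholtzOp Ω (ΓD ∪ ΓR) κ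
  have hform : ∀ u v, Helmholtz.form κ u v = inner ℂ (J v) (A (J u)) :=
    Helmholtz.form_eq_inner_helmholtzOp hD hDR κ
  -- Conjugation preserves real parts, so the adjoint operator is coercive with the same constant
  -- and Lax–Milgram also solves the dual problem.
  have hform' : ∀ u v, Helmholtz.form κ u v = conj (inner ℂ (J u) (A.adjoint (J v))) := by
    intro u v
    rw [hform, ContinuousLinearMap.adjoint_inner_right, inner_conj_symm]
  have hK : 0 < (κ ^ 2)⁻¹ + 1 + |Ca| / κ := by positivity
  have hA : ∀ w ∈ T.W ΓD ΓR, 1 / 3 * ((κ ^ 2)⁻¹ + 1 + |Ca| / κ)⁻¹ * ‖J w‖ ^ 2 ≤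
      (Helmholtz.form κ w w).re := by
    intro w hw
    refine le_trans ?_ (hcoer w hw)
    rw [mul_assoc]
    refine mul_le_mul_of_nonneg_left ?_ (by norm_num)
    rw [inv_mul_le_iff₀ hK]
    exact Helmholtz.norm_embed_sq_le hD hDR hκ hCa w
  have hc : 0 < 1 / 3 * ((κ ^ 2)⁻¹ + 1 + |Ca| / κ)⁻¹ := by positivity
  obtain ⟨C, hC⟩ := Helmholtz.exists_linearMap_inner_eq J Helmholtz.embed_injective (T.W ΓD ΓR)
    (T.isClosed_map_embed_W hD) A hc fun w hw => (hform w w) ▸ hA w hw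
  obtain ⟨Cs, hCs⟩ := Helmholtz.exists_linearMap_inner_eq J Helmholtz.embed_injective (T.W ΓD ΓR)
    (T.isClosed_map_embed_W hD) A.adjoint hc fun w hw => by
      have h := hA w hw
      rwa [hform', Complex.conj_re] at h
  have hCeq : ∀ v, ∀ w ∈ T.W ΓD ΓR, Helmholtz.form κ (C v).1 w = Helmholtz.form κ v w := by
    intro v w hw
    rw [hform, hform, hC v w hw]
  have hCseq : ∀ v, ∀ w ∈ T.W ΓD ΓR, Helmholtz.form κ w (Cs v).1 = Helmholtz.form κ w v := by
    intro v w hw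
    rw [hform', hform', hCs v w hw]
  -- Serves both problems: the difference of two solutions is itself an admissible test function.
  have huniq : ∀ c c' : T.W ΓD ΓR, Helmholtz.form κ (c.1 - c'.1) (c.1 - c'.1) = 0 → c = c' := by
    intro c c' h
    have hn := hcoer (c.1 - c'.1) (sub_mem c.2 c'.2)
    rw [h, Complex.zero_re] at hn
    have hz : Helmholtz.normV κ (c.1 - c'.1) = 0 :=
      (pow_eq_zero_iff two_ne_zero).mp (le_antisymm (by linarith) (sq_nonneg _))
    exact Subtype.ext (sub_eq_zero.mp (Helmholtz.eq_zero_of_normV_eq_zero hD hDR hκ hCa hz))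
  have hCsuniq : ∀ v (c : T.W ΓD ΓR),
      (∀ w ∈ T.W ΓD ΓR, Helmholtz.form κ w c.1 = Helmholtz.form κ w v) → c = Cs v := by
    intro v c h
    refine huniq _ _ ?_
    have hm : c.1 - (Cs v).1 ∈ T.W ΓD ΓR := sub_mem c.2 (Cs v).2
    rw [Helmholtz.form_sub_right hD hDR, h _ hm, hCseq v _ hm, sub_self]
  refine ⟨C, Cs, fun v c => ⟨fun h => huniq _ _ ?_, ?_⟩, fun v c => ⟨hCsuniq v c, ?_⟩,
    fun v => ⟨?_, ?_⟩, fun v => ?_⟩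
  · have hm : c.1 - (C v).1 ∈ T.W ΓD ΓR := sub_mem c.2 (C v).2
    rw [Helmholtz.form_sub_left hD hDR, h _ hm, hCeq v _ hm, sub_self]
  · rintro rfl
    exact hCeq v
  · rintro rfl
    exact hCseq v
  · refine Helmholtz.normV_le_three_mul hCa ((hcoer _ (C v).2).trans ?_)
    rw [hCeq v _ (C v).2]
    exact (Complex.re_le_norm _).trans (hCa _ _)
  · refine Helmholtz.normV_le_three_mul hCa ((hcoer _ (Cs v).2).trans ?_)
    rw [hCseq v _ (Cs v).2]
    refine (Complex.re_le_norm _).trans ((hCa _ _).trans_eq ?_)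
    ring
  · obtain ⟨v', hv⟩ := Helmholtz.exists_isConj v
    obtain ⟨c, hc⟩ := Helmholtz.exists_isConj (C v').1
    -- The conjugate `c` of `C v'` solves the dual problem, since `a(w, c) = a(C v', w') = a(v', w')
    -- = a(w, v)` with `w'` the conjugate of `w`; uniqueness concludes.
    have hcs : (⟨c, T.mem_W_of_isConj hc (C v').2⟩ : T.W ΓD ΓR) = Cs v := by
      refine hCsuniq v _ fun w hw => ?_
      obtain ⟨w', hw'⟩ := Helmholtz.exists_isConj w
      rw [hw'.symm.form_eq hc, hCeq v' _ (T.mem_W_of_isConj hw' hw),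
        hw'.symm.form_eq hv.symm]
    refine ⟨v', hv, ?_, ?_⟩
    · rw [← hcs]
      exact hc
    · rw [← hcs]
      exact hc.normV_eq κ
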